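/- Fix an integer $d\ge 1$; all graphs are finite and simple. For a graph $G=(V,E)$ and $p\colon V\to\mathbb{C}^d$, the pair $(G,p)$ is a framework in $\mathbb{C}^d$; it is generic if the $d|V|$ coordinates of $p$ are algebraically independent over $\mathbb{Q}$ (likewise over $\mathbb{R}$). The complex squared length of an edge $uv$ in $(G,p)$ is $\sum_{k=1}^d (p(u)_k-p(v)_k)^2$. Frameworks $(G,p)$ and $(H,q)$ in $\mathbb{C}^d$ are length-equivalent under a bijection $\psi\colon E(G)\to E(H)$ if every edge $e$ of $G$ has the same complex squared length in $(G,p)$ as $\psi(e)$ has in $(H,q)$. A graph $G$ without isolated vertices is fully reconstructible in $\mathbb{C}^d$ if for every generic framework $(G,p)$ in $\mathbb{C}^d$, every graph $H$ without isolated vertices (on any number of vertices), and every generic framework $(H,q)$ in $\mathbb{C}^d$ that is length-equivalent to $(G,p)$ under some bijection $\psi\colon E(G)\to E(H)$, there is a graph isomorphism $\varphi\colon V(G)\to V(H)$ with $\psi(uv)=\varphi(u)\varphi(v)$ for all $uv\in E(G)$. The $d$-dimensional rigidity matroid of $G$ is the matroid on $E$ given by linear independence of the rows of the rigidity matrix $R(G,p)$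 of a generic $p\colon V\to\mathbb{R}^d$ (it does not depend on the choice of $p$); the row of $R(G,p)$ of an edge $uv$ has $p(u)-p(v)$ in the $d$ columns of $u$, $p(v)-p(u)$ in the $d$ columns of $v$, and zeros elsewhere. $G$ is $M$-connected in $\mathbb{R}^d$ if this matroid is connected, i.e. any two distinct edges lie on a common circuit. **Theorem.** Let $G$ be a graph without isolated vertices that is fully reconstructible in $\mathbb{C}^d$. Then $G$ is $M$-connected in $\mathbb{R}^d$. -/

import Mathlib

universe u

namespace RigidityTheory

/-- A configuration `p : V → K^d` is generic if its coordinates are algebraically independent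
over `ℚ`. -/
def IsGeneric {V K : Type*} [Field K] [Algebra ℚ K] {d : ℕ} (p : V → Fin d → K) : Prop :=
  AlgebraicIndependent ℚ (fun x : V × Fin d => p x.1 x.2)

/-- The complex squared length `∑ k, (p u k - p v k) ^ 2` of the pair `uv` in the configuration
`p` (no conjugation). -/
def sqLength {V : Type*} {d : ℕ} (p : V → Fin d → ℂ) : Sym2 V → ℂ :=
  Sym2.lift ⟨fun u v => ∑ k, (p u k - p v k) ^ 2, fun u v =>
    Finset.sum_congr rfl fun k _ => by ring⟩

/-- The row of the rigidity matrix belonging to the pair `uv`: the block of columns of `u` holds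
`p u - p v`, the block of columns of `v` holds `p v - p u`, and all other entries are zero. -/
noncomputable def rigidityRow {V K : Type*} [Field K] {d : ℕ} (p : V → Fin d → K) :
    Sym2 V → V × Fin d → K :=
  open scoped Classical in
  Sym2.lift ⟨fun u v x =>
      (if x.1 = u then p u x.2 - p v x.2 else 0) + (if x.1 = v then p v x.2 - p u x.2 else 0),
    fun _ _ => funext fun _ => add_comm _ _⟩

/-- The rigidity matrix `R(G, p)`, of size `|E| × d|V|`. -/
noncomputable def rigidityMatrix {V K : Type*} [Field K] {d : ℕ} (G : SimpleGraph V)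
    (p : V → Fin d → K) : Matrix G.edgeSet (V × Fin d) K :=
  Matrix.of fun e => rigidityRow p (e : Sym2 V)

/-- The matroid on a finite index set `ι` defined by linear independence of a family of vectors. -/
def vectorMatroid {ι K M : Type*} [Finite ι] [Field K] [AddCommGroup M] [Module K M]
    (v : ι → M) : Matroid ι :=
  (IndepMatroid.ofFinite (E := Set.univ) Set.finite_univ (fun I => LinearIndepOn K v I)
    (linearIndepOn_empty K v)
    (fun _ _ hJ hIJ => hJ.mono hIJ)
    (fun I J hI hJ hlt => by
      by_contra! hcon
      have hsub : v '' J ⊆ Submodule.span K (v '' I) := by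
        rintro _ ⟨e, he, rfl⟩
        by_cases heI : e ∈ I
        · exact Submodule.subset_span ⟨e, heI, rfl⟩
        · by_contra hns
          exact hcon e he heI (hI.insert hns)
      have hle : Submodule.span K (v '' J) ≤ Submodule.span K (v '' I) :=
        Submodule.span_le.2 hsub
      have hfin : (v '' I).Finite := I.toFinite.image v
      have := FiniteDimensional.span_of_finite K hfin
      have h := Submodule.finrank_mono hle
      have hc : ∀ S : Set ι, LinearIndepOn K v S →
          Module.finrank K (Submodule.span K (v '' S)) = S.ncard := by
        intro S hS
        have := Fintype.ofFinite S
        have h1 := finrank_span_eq_card (R := K) (b := fun x : S => v x) hS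
        rw [← Set.image_eq_range] at h1
        rw [h1, ← Nat.card_coe_set_eq, Nat.card_eq_fintype_card]
      rw [hc J hJ, hc I hI] at h
      omega)
    (fun _ _ => Set.subset_univ _)).matroid

/-- The rigidity matroid of the framework `(G, p)`: the ground set is the edge set of `G`, and a
set of edges is independent if the corresponding rows of `R(G, p)` are linearly independent. -/
noncomputable def rigidityMatroid {V K : Type*} [Finite V] [Field K] {d : ℕ} (G : SimpleGraph V)
    (p : V → Fin d → K) : Matroid G.edgeSet :=
  vectorMatroid (K := K) (rigidityMatrix G p).row

/-- A matroid is connected if any two of its elements are equal or lie on a common circuit. -/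
def MatroidConnected {α : Type*} (M : Matroid α) : Prop :=
  ∀ e ∈ M.E, ∀ f ∈ M.E, e = f ∨ ∃ C, M.IsCircuit C ∧ e ∈ C ∧ f ∈ C

/-- `G` is `M`-connected in `ℝ^d` if its `d`-dimensional generic rigidity matroid, i.e. the rigidity
matroid of any generic framework `(G, p)` in `ℝ^d`, is connected. -/
def IsMConnected {V : Type*} [Finite V] (d : ℕ) (G : SimpleGraph V) : Prop :=
  ∀ p : V → Fin d → ℝ, IsGeneric p → MatroidConnected (rigidityMatroid G p)

/-- The graph has no isolated vertices. -/
def NoIsolated {V : Type*} (G : SimpleGraph V) : Prop :=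
  ∀ v, ¬ G.IsIsolated v

/-- The frameworks `(G, p)` and `(H, q)` are length-equivalent under the edge bijection `ψ`. -/
def LengthEquivalent {V W : Type*} {d : ℕ} (G : SimpleGraph V) (p : V → Fin d → ℂ)
    (H : SimpleGraph W) (q : W → Fin d → ℂ) (ψ : G.edgeSet ≃ H.edgeSet) : Prop :=
  ∀ e : G.edgeSet, sqLength p (e : Sym2 V) = sqLength q (ψ e : Sym2 W)

/-- The framework `(G, p)` is fully reconstructible: whenever `(H, q)` is a generic framework in
`ℂ^d`, where `H` is a finite graph without isolated vertices (on any number of vertices), that is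
length-equivalent to `(G, p)` under an edge bijection `ψ`, there is a graph isomorphism `φ`
from `G` to `H` with `ψ(uv) = φ(u)φ(v)` for every edge `uv` of `G`. -/
def FrameworkFullyReconstructible {V : Type u} {d : ℕ} (G : SimpleGraph V)
    (p : V → Fin d → ℂ) : Prop :=
  ∀ (W : Type u) [Finite W] (H : SimpleGraph W) (q : W → Fin d → ℂ) (ψ : G.edgeSet ≃ H.edgeSet),
    NoIsolated H → IsGeneric q → LengthEquivalent G p H q ψ →
      ∃ φ : G ≃g H, ∀ e : G.edgeSet, (ψ e : Sym2 W) = Sym2.map φ (e : Sym2 V)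

/-- The graph `G` is (generically) fully reconstructible in `ℂ^d`: every generic realization of
`G` in `ℂ^d` is fully reconstructible. -/
def IsFullyReconstructible {V : Type u} (d : ℕ) (G : SimpleGraph V) : Prop :=
  ∀ p : V → Fin d → ℂ, IsGeneric p → FrameworkFullyReconstructible G p

end RigidityTheory

/-!
Suppose that the generic rigidity matroid of `G` is not connected. Lying on a common circuit is an
equivalence relation (`Matroid.exists_isCircuit_trans`), so the edges of `G` can be coloured with
two colours, both used, such that every circuit is monochromatic. From a generic framework `(G, p)`
a length-equivalent generic framework `(H, q)` is built on a graph `H` with a different number of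
vertices, which contradicts full reconstructibility.

If no vertex meets both colours, `G` is disconnected. Translating one colour class by
`p v₁ - p v₂`, with `v₁` and `v₂` of different colours, moves `v₂` onto `v₁` without changing any
edge length; identifying the two vertices leaves a generic configuration with one vertex fewer
(`exists_isGeneric_glue`).

Otherwise `H` is obtained by splitting every vertex that meets both colours into two, one for each
colour, so that `H` is the disjoint union of the two coloured subgraphs and has more vertices than
`G`. The point is that the edge lengths of generic frameworks of `G` and of `H` satisfy the same
polynomial relations over `ℚ`. Every relation for `H` holds for `G`, because frameworks of `G` are
special frameworks of `H`. The ideal of relations of `H` is therefore contained in that of `G`, and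
both are prime, so it suffices that they have the same dimension. In characteristic zero,
elements of a field are algebraically independent over `ℚ` if and only if their Kähler differentials
are linearly independent (`algebraicIndepOn_iff_linearIndepOn_D`); as the differential of the
squared length of an edge is twice its row of the rigidity matrix, paired with the independent
differentials of the coordinates, the algebraic matroid of the edge lengths is the rigidity matroid.
Each edge outside a base `B` depends on the edges of `B` of its own colour, and relations among
edges of one colour are the same for `G` and `H`. Hence the lengths of `B` form a transcendence
basis of the field of lengths for both graphs (`MvPolynomial.aeval_eq_zero_of_coloring`).

Since the relations agree, sending the lengths of a generic framework `q₀` of `H` to those of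
`(G, p)` extends to a field endomorphism `σ` of `ℂ`
(`Complex.exists_ringHom_of_aeval_eq_zero_iff`), and `q = σ ∘ q₀` is generic with the lengths of
`(G, p)`.
-/

/-! ### Differentials and algebraic independence -/

section Algebra

open MvPolynomial

/-- The field `K` is formally étale over the polynomial ring on a transcendence basis, being a
separable algebraic extension of its fraction field, so `Ω[K⁄k]` is obtained by base change from the
free module of differentials of the polynomial ring. -/
lemma IsTranscendenceBasis.linearIndependent_D {k K ι : Type*} [Field k] [Field K] [CharZero k]
    [Algebra k K] {v : ι → K} (hv : IsTranscendenceBasis k v) :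
    LinearIndependent K fun i => KaehlerDifferential.D k K (v i) := by
  let _ : Algebra (MvPolynomial ι k) K := (aeval v).toAlgebra
  have hmap : ∀ P : MvPolynomial ι k, algebraMap (MvPolynomial ι k) K P = aeval v P :=
    fun _ => rfl
  have : IsScalarTower k (MvPolynomial ι k) K :=
    .of_algebraMap_eq fun r => by rw [hmap, MvPolynomial.algebraMap_eq, aeval_C]
  have : FaithfulSMul (MvPolynomial ι k) K :=
    (faithfulSMul_iff_algebraMap_injective _ _).2 hv.1
  have : Algebra.IsAlgebraic (Algebra.adjoin k (Set.range v)) K := hv.isAlgebraic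
  have : Algebra.IsAlgebraic (MvPolynomial ι k) K :=
    Algebra.IsAlgebraic.of_ringHom_of_comp_eq (S := Algebra.adjoin k (Set.range v)) (B := K)
      hv.1.aevalEquiv.toRingEquiv (RingHom.id K) hv.1.aevalEquiv.surjective
      Function.injective_id (by ext <;> simp [hmap])
  let _ := FractionRing.liftAlgebra (MvPolynomial ι k) K
  have := FractionRing.isScalarTower_liftAlgebra (MvPolynomial ι k) K
  have : Algebra.IsAlgebraic (FractionRing (MvPolynomial ι k)) K :=
    (IsFractionRing.comap_isAlgebraic_iff (A := MvPolynomial ι k)).1 inferInstance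
  have : CharZero (FractionRing (MvPolynomial ι k)) :=
    charZero_of_injective_algebraMap (R := MvPolynomial ι k)
      (IsFractionRing.injective _ _)
  have : Algebra.FormallyEtale (FractionRing (MvPolynomial ι k)) K :=
    Algebra.FormallyEtale.of_isSeparable _ K
  have : Algebra.FormallyEtale (MvPolynomial ι k) (FractionRing (MvPolynomial ι k)) :=
    Algebra.FormallyEtale.of_isLocalization (nonZeroDivisors _)
  have : Algebra.FormallyEtale (MvPolynomial ι k) K :=
    Algebra.FormallyEtale.comp _ (FractionRing (MvPolynomial ι k)) _
  let b := ((KaehlerDifferential.mvPolynomialBasis k ι).baseChange K).map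
    (KaehlerDifferential.tensorKaehlerEquivOfFormallyEtale k (MvPolynomial ι k) K)
  have hb : ⇑b = fun i => KaehlerDifferential.D k K (v i) := by
    funext i
    simp [b, hmap]
  exact hb ▸ b.linearIndependent

lemma AlgebraicIndependent.linearIndependent_D {k K ι : Type*} [Field k] [Field K] [CharZero k]
    [Algebra k K] {v : ι → K} (hv : AlgebraicIndependent k v) :
    LinearIndependent K fun i => KaehlerDifferential.D k K (v i) := by
  obtain ⟨t, hst, ht⟩ := exists_isTranscendenceBasis_superset hv.coe_range
  exact (IsTranscendenceBasis.linearIndependent_D ht).comp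
    (fun i => (⟨v i, hst ⟨i, rfl⟩⟩ : t)) fun i j hij => hv.injective (congrArg Subtype.val hij)

/-- Modulo the span of the differentials of `s`, the universal derivation is linear over the field
generated by `s`; applied to a separable minimal polynomial of `x` it must kill `x`. -/
lemma KaehlerDifferential.D_mem_span_of_isAlgebraic {k K : Type*} [Field k] [Field K] [CharZero k]
    [Algebra k K] {s : Set K} {x : K} (hx : IsAlgebraic (Algebra.adjoin k s) x) :
    KaehlerDifferential.D k K x ∈ Submodule.span K (KaehlerDifferential.D k K '' s) := by
  set N := Submodule.span K (KaehlerDifferential.D k K '' s)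
  let δ : Derivation k K (Ω[K⁄k] ⧸ N) := N.mkQ.compDer (KaehlerDifferential.D k K)
  have hδ : ∀ a ∈ IntermediateField.adjoin k s, δ a = 0 := by
    intro a ha
    induction ha using IntermediateField.adjoin_induction with
    | mem a ha =>
      exact (Submodule.Quotient.mk_eq_zero N).2 (Submodule.subset_span ⟨a, ha, rfl⟩)
    | algebraMap r => exact δ.map_algebraMap r
    | add a b _ _ ha hb => rw [map_add, ha, hb, add_zero]
    | inv a _ ha => rw [δ.leibniz_inv, ha, smul_zero]
    | mul a b _ _ ha hb => rw [δ.leibniz, ha, hb, smul_zero, smul_zero, add_zero]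
  have : CharZero K := charZero_of_injective_algebraMap (algebraMap k K).injective
  let δ' : Derivation (IntermediateField.adjoin k s) K (Ω[K⁄k] ⧸ N) :=
    { toFun := δ
      map_add' := map_add δ
      map_smul' := fun a b => by
        rw [Algebra.smul_def, δ.leibniz]
        change (a : K) • δ b + b • δ (a : K) = (a : K) • δ b
        rw [hδ a a.2, smul_zero, add_zero]
      map_one_eq_zero' := δ.map_one_eq_zero
      leibniz' := δ.leibniz }
  have hx' : IsIntegral (IntermediateField.adjoin k s) x :=
    (IsAlgebraic.ringHom_of_comp_eq
      (Subalgebra.inclusion (IntermediateField.algebra_adjoin_le_adjoin k s)).toRingHom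
      (RingHom.id K) hx (Subalgebra.inclusion_injective _) rfl).isIntegral
  have h := δ'.map_aeval (minpoly (IntermediateField.adjoin k s) x) x
  rw [minpoly.aeval, map_zero] at h
  have hsep : Polynomial.aeval x (Polynomial.derivative
      (minpoly (IntermediateField.adjoin k s) x)) ≠ 0 :=
    (minpoly.irreducible hx').separable.aeval_derivative_ne_zero (minpoly.aeval _ _)
  exact (Submodule.Quotient.mk_eq_zero N).1 ((smul_eq_zero.1 h.symm).resolve_left hsep)

/-- The Jacobian criterion in characteristic zero: a finite family of a field extension is
algebraically independent if and only if its differentials are linearly independent. -/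
lemma algebraicIndepOn_iff_linearIndepOn_D {k K ι : Type*} [Field k] [Field K] [CharZero k]
    [Algebra k K] (v : ι → K) {S : Set ι} (hS : S.Finite) :
    AlgebraicIndepOn k v S ↔ LinearIndepOn K (fun i => KaehlerDifferential.D k K (v i)) S := by
  refine ⟨fun h => AlgebraicIndependent.linearIndependent_D h, ?_⟩
  induction S, hS using Set.Finite.induction_on with
  | empty =>
    intro _
    exact algebraicIndependent_empty_type_iff.2 (algebraMap k K).injective
  | @insert a S ha _ ih =>
    intro h
    refine (AlgebraicIndepOn.insert_iff ha).2 ⟨ih (h.mono (Set.subset_insert _ _)), fun halg => ?_⟩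
    refine ((linearIndepOn_insert ha).1 h).2 ?_
    have := KaehlerDifferential.D_mem_span_of_isAlgebraic halg
    rwa [Set.image_image] at this

/-- If the relations of the family `z` hold for `y`, and a subfamily of `z` over which all of `z` is
algebraic becomes algebraically independent in `y`, then `y` and `z` have the same relations. -/
lemma MvPolynomial.aeval_eq_zero_of_isAlgebraic {k K L E : Type*} [Field k] [Field K] [Field L]
    [Algebra k K] [Algebra k L] {y : E → L} {z : E → K} {B : Set E}
    (hzy : ∀ P : MvPolynomial E k, aeval z P = 0 → aeval y P = 0)
    (hy : AlgebraicIndepOn k y B)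
    (halg : ∀ e, IsAlgebraic (Algebra.adjoin k (z '' B)) (z e))
    (P : MvPolynomial E k) (hP : aeval y P = 0) : aeval z P = 0 := by
  by_contra hne
  have hz : AlgebraicIndepOn k z B := by
    refine algebraicIndependent_iff.2 fun Q hQ => ?_
    refine algebraicIndependent_iff.1 hy Q ?_
    have := hzy (rename (↑) Q) (by rwa [aeval_rename])
    rwa [aeval_rename] at this
  have ha : IsAlgebraic (Algebra.adjoin k (z '' B)) (aeval z P) := by
    clear hP hne
    induction P using MvPolynomial.induction_on with
    | C r =>
      rw [aeval_C, IsScalarTower.algebraMap_apply k (Algebra.adjoin k (z '' B)) K]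
      exact isAlgebraic_algebraMap _
    | add p q hp hq => rw [map_add]; exact hp.add hq
    | mul_X p e hp => rw [map_mul, aeval_X]; exact hp.mul (halg e)
  rw [Set.image_eq_range] at ha
  let φ := AlgebraicIndependent.aevalEquiv hz
  -- The nonzero element `aeval z P` is a root of some `F` with nonzero constant term. The relation
  -- `F (P) = 0` passes to `y`, where `P` vanishes, so that the constant term of `F` vanishes on the
  -- independent family `y`.
  obtain ⟨F, hF0, hF⟩ := ha.exists_nonzero_coeff_and_aeval_eq_zero
    (mem_nonZeroDivisors_of_ne_zero hne)
  set F' : Polynomial (MvPolynomial B k) := F.map φ.symm.toRingEquiv.toRingHom with hF'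
  have key : aeval z (Polynomial.eval₂ (rename (↑) : MvPolynomial B k →ₐ[k] _).toRingHom P F')
      = 0 := by
    rw [← hF, ← AlgHom.coe_toRingHom, Polynomial.hom_eval₂, hF', Polynomial.eval₂_map,
      Polynomial.aeval_def]
    congr 1
    refine RingHom.ext fun x => ?_
    obtain ⟨Q, rfl⟩ := φ.surjective x
    simp [φ, aeval_rename, Function.comp_def]
  have key' := hzy _ key
  rw [← AlgHom.coe_toRingHom, Polynomial.hom_eval₂, AlgHom.coe_toRingHom, hP,
    Polynomial.eval₂_at_zero] at key'
  have h0 : F'.coeff 0 = 0 := by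
    refine algebraicIndependent_iff.1 hy _ ?_
    simpa [aeval_rename, Function.comp_def] using key'
  rw [hF', Polynomial.coeff_map] at h0
  exact hF0 ((map_eq_zero_iff _ φ.symm.injective).1 h0)

/-- A dependence among the `y e` carries over to the `z e` if the relations of `y` on a larger set
of indices hold for `z`. -/
lemma AlgebraicIndepOn.not_of_aeval_imp {k K L E : Type*} [Field k] [Field K] [Field L]
    [Algebra k K] [Algebra k L] {y : E → L} {z : E → K} {T S : Set E}
    (hyz : ∀ P : MvPolynomial T k, aeval (fun e : T => y e) P = 0 →
      aeval (fun e : T => z e) P = 0) (hST : S ⊆ T)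
    (hy : ¬ AlgebraicIndepOn k y S) : ¬ AlgebraicIndepOn k z S := by
  refine fun hz => hy (algebraicIndependent_iff.2 fun Q hQ => ?_)
  refine algebraicIndependent_iff.1 hz Q ?_
  have := hyz (rename (Set.inclusion hST) Q) (by rwa [aeval_rename])
  rwa [aeval_rename] at this

/-- The index set is split into two colours, and relations of `y` of one colour hold for `z`. If
there is an algebraically independent subfamily `B` of `y` such that each other `y e` depends on the
members of `B` of its own colour, then the relations of `y` and `z` agree as soon as those of `z`
hold for `y`. -/
lemma MvPolynomial.aeval_eq_zero_of_coloring {k K L E : Type*} [Field k] [Field K] [Field L]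
    [Algebra k K] [Algebra k L] {y : E → L} {z : E → K} {B : Set E} (c : E → Bool)
    (hzy : ∀ P : MvPolynomial E k, aeval z P = 0 → aeval y P = 0)
    (hyz : ∀ b, ∀ P : MvPolynomial {e | c e = b} k,
      aeval (fun e : {e | c e = b} => y e) P = 0 → aeval (fun e : {e | c e = b} => z e) P = 0)
    (hy : AlgebraicIndepOn k y B)
    (hB : ∀ e ∉ B, ¬ AlgebraicIndepOn k y (insert e {f ∈ B | c f = c e}))
    (P : MvPolynomial E k) (hP : aeval y P = 0) : aeval z P = 0 := by
  refine MvPolynomial.aeval_eq_zero_of_isAlgebraic hzy hy (fun e => ?_) P hP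
  by_cases he : e ∈ B
  · exact isAlgebraic_algebraMap
      (⟨z e, Algebra.subset_adjoin ⟨e, he, rfl⟩⟩ : Algebra.adjoin k (z '' B))
  have hz : AlgebraicIndepOn k z {f ∈ B | c f = c e} := by
    by_contra h
    refine AlgebraicIndepOn.not_of_aeval_imp (T := Set.univ) (fun P hP => ?_)
      (Set.subset_univ _) h (hy.mono (Set.sep_subset _ _))
    have := hzy (rename (↑) P) (by rwa [aeval_rename])
    rwa [aeval_rename] at this
  have hz' := AlgebraicIndepOn.not_of_aeval_imp (hyz (c e))
    (Set.insert_subset rfl fun f hf => hf.2) (hB e he)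
  rw [AlgebraicIndepOn.insert_iff (fun h => he h.1)] at hz'
  have halg : IsAlgebraic (Algebra.adjoin k (z '' {f ∈ B | c f = c e})) (z e) :=
    not_not.1 fun h => hz' ⟨hz, h⟩
  have hle : Algebra.adjoin k (z '' {f ∈ B | c f = c e}) ≤ Algebra.adjoin k (z '' B) :=
    Algebra.adjoin_mono (Set.image_mono (Set.sep_subset _ _))
  exact IsAlgebraic.ringHom_of_comp_eq (Subalgebra.inclusion hle).toRingHom (RingHom.id K) halg
    (Subalgebra.inclusion_injective _) rfl

open Cardinal in
/-- Two embeddings of a countable ring into uncountable algebraically closed fields of the same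
cardinality differ by a field homomorphism, as the fields have equipotent transcendence bases over
the ring. -/
lemma IsAlgClosed.exists_ringHom_extending {R K L : Type*} [CommRing R] [Field K] [Field L]
    [IsAlgClosed K] [IsAlgClosed L] (f : R →+* K) (g : R →+* L)
    (hf : Function.Injective f) (hg : Function.Injective g)
    (hR : #R ≤ ℵ₀) (hK : ℵ₀ < #K) (hKL : Nonempty (K ≃ L)) :
    ∃ σ : K →+* L, ∀ r, σ (f r) = g r := by
  have : Nontrivial R := f.domain_nontrivial
  let _ : Algebra R K := f.toAlgebra
  let _ : Algebra R L := g.toAlgebra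
  have : FaithfulSMul R K := (faithfulSMul_iff_algebraMap_injective _ _).2 hf
  have : FaithfulSMul R L := (faithfulSMul_iff_algebraMap_injective _ _).2 hg
  obtain ⟨s, hs⟩ := exists_isTranscendenceBasis R K
  obtain ⟨t, ht⟩ := exists_isTranscendenceBasis R L
  have hL : ℵ₀ < #L := by
    rwa [← aleph0_lt_lift, ← lift_mk_eq'.2 hKL, aleph0_lt_lift]
  have hs' := lift_injective
    (IsAlgClosed.cardinal_eq_cardinal_transcendence_basis_of_aleph0_lt _ hs hR hK)
  have ht' := lift_injective
    (IsAlgClosed.cardinal_eq_cardinal_transcendence_basis_of_aleph0_lt _ ht hR hL)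
  obtain ⟨e⟩ := lift_mk_eq'.1 (hs' ▸ ht' ▸ lift_mk_eq'.2 hKL)
  have ht2 : AlgebraicIndependent R fun i : s => (e i : L) := ht.1.comp e e.injective
  let A := Algebra.adjoin R (Set.range ((↑) : s → K))
  let h : A →ₐ[R] L := (aeval fun i : s => (e i : L)).comp hs.1.aevalEquiv.symm.toAlgHom
  have hh : Function.Injective h :=
    (algebraicIndependent_iff_injective_aeval.1 ht2).comp hs.1.aevalEquiv.symm.injective
  let _ : Algebra A L := h.toRingHom.toAlgebra
  have : FaithfulSMul A L := (faithfulSMul_iff_algebraMap_injective _ _).2 hh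
  have : Algebra.IsAlgebraic A K := hs.isAlgebraic
  let τ : K →ₐ[A] L := IsAlgClosed.lift
  refine ⟨τ.toRingHom, fun r => ?_⟩
  have h1 := τ.commutes (algebraMap R A r)
  have h2 : algebraMap A L (algebraMap R A r) = g r := h.commutes r
  rw [h2] at h1
  exact h1

lemma Complex.exists_ringHom_of_aeval_eq_zero_iff {E : Type*} [Finite E] {y z : E → ℂ}
    (h : ∀ P : MvPolynomial E ℚ, aeval z P = 0 ↔ aeval y P = 0) :
    ∃ σ : ℂ →+* ℂ, ∀ e, σ (z e) = y e := by
  let I : Ideal (MvPolynomial E ℚ) := RingHom.ker (aeval z : MvPolynomial E ℚ →ₐ[ℚ] ℂ)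
  let f : MvPolynomial E ℚ ⧸ I →+* ℂ :=
    Ideal.Quotient.lift I (aeval z : MvPolynomial E ℚ →ₐ[ℚ] ℂ).toRingHom fun P hP => hP
  let g : MvPolynomial E ℚ ⧸ I →+* ℂ :=
    Ideal.Quotient.lift I (aeval y : MvPolynomial E ℚ →ₐ[ℚ] ℂ).toRingHom fun P hP => (h P).1 hP
  have hf : Function.Injective f := RingHom.kerLift_injective _
  have hg : Function.Injective g := by
    refine (injective_iff_map_eq_zero g).2 fun x hx => ?_
    obtain ⟨P, rfl⟩ := Ideal.Quotient.mk_surjective x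
    exact Ideal.Quotient.eq_zero_iff_mem.2 ((h P).2 hx)
  have hR : Cardinal.mk (MvPolynomial E ℚ ⧸ I) ≤ Cardinal.aleph0 := by
    have h1 : Cardinal.mk (MvPolynomial E ℚ) ≤ Cardinal.aleph0 := by
      refine (MvPolynomial.cardinalMk_le_max_lift).trans ?_
      simp
    exact Cardinal.mk_quotient_le.trans h1
  obtain ⟨σ, hσ⟩ := IsAlgClosed.exists_ringHom_extending f g hf hg hR
    (by rw [Cardinal.mk_complex]; exact Cardinal.aleph0_lt_continuum) ⟨Equiv.refl ℂ⟩
  refine ⟨σ, fun e => ?_⟩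
  have h1 := hσ (Ideal.Quotient.mk I (X e))
  have h2 : f (Ideal.Quotient.mk I (X e)) = z e := aeval_X z e
  have h3 : g (Ideal.Quotient.mk I (X e)) = y e := aeval_X y e
  rwa [h2, h3] at h1

lemma Complex.exists_algebraicIndependent (ι : Type*) [Finite ι] :
    ∃ v : ι → ℂ, AlgebraicIndependent ℚ v := by
  obtain ⟨s, hs⟩ := exists_isTranscendenceBasis ℚ ℂ
  have h := IsAlgClosed.cardinal_eq_cardinal_transcendence_basis_of_aleph0_lt' _ hs
    (by simp) (by rw [Cardinal.mk_complex]; exact Cardinal.aleph0_lt_continuum)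
  have : Infinite s := by
    rw [Cardinal.infinite_iff, ← h, Cardinal.mk_complex]
    exact Cardinal.aleph0_le_continuum
  obtain ⟨n, ⟨e⟩⟩ := Finite.exists_equiv_fin ι
  refine ⟨fun i => (Infinite.natEmbedding s (e i) : ℂ), hs.1.comp
    (fun i => Infinite.natEmbedding s (e i)) ?_⟩
  exact (Infinite.natEmbedding s).injective.comp (Fin.val_injective.comp e.injective)

lemma AlgebraicIndependent.aeval_of_injective {R A ι κ : Type*} [CommRing R] [CommRing A]
    [Algebra R A] {x : ι → A} (hx : AlgebraicIndependent R x)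
    (Φ : MvPolynomial κ R →ₐ[R] MvPolynomial ι R) (hΦ : Function.Injective Φ) :
    AlgebraicIndependent R fun i => aeval x (Φ (X i)) := by
  rw [algebraicIndependent_iff_injective_aeval] at hx ⊢
  have : aeval (fun i => aeval x (Φ (X i))) = (aeval x).comp Φ := by
    ext i
    simp
  rw [this]
  exact hx.comp hΦ

end Algebra

/-! ### Circuits and connectivity of a matroid -/

/-- Lying on a common circuit is transitive: if the circuits `C ∋ e` and `D ∋ f` meet, then some
circuit contains both `e` and `f`. The proof is by induction on a bound `n` for `(C ∪ D).ncard`. -/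
lemma Matroid.exists_isCircuit_trans {α : Type*} [Finite α] {M : Matroid α} {e f : α} :
    ∀ (n : ℕ) {C D : Set α}, M.IsCircuit C → M.IsCircuit D → e ∈ C → f ∈ D → (C ∩ D).Nonempty →
      (C ∪ D).ncard ≤ n → ∃ C', M.IsCircuit C' ∧ e ∈ C' ∧ f ∈ C' := by
  intro n
  induction n with
  | zero =>
    intro C D _ _ he _ _ hn
    rw [Nat.le_zero, Set.ncard_eq_zero] at hn
    exact (Set.eq_empty_iff_forall_notMem.1 hn e (Or.inl he)).elim
  | succ n ih =>
    intro C D hC hD he hf ⟨x, hxC, hxD⟩ hn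
    by_cases heD : e ∈ D
    · exact ⟨D, hD, heD, hf⟩
    obtain ⟨C₃, hC₃s, hC₃, heC₃⟩ := hC.strong_elimination hD hxC hxD he heD
    by_cases hfC₃ : f ∈ C₃
    · exact ⟨C₃, hC₃, heC₃, hfC₃⟩
    -- `C₃` is not contained in `C`, as it misses `x`.
    have h1 : ¬ C₃ ⊆ C := fun h =>
      (hC₃s (hC₃.eq_of_subset_isCircuit hC h ▸ hxC)).2 rfl
    obtain ⟨y, hyC₃, hyC⟩ := Set.not_subset.1 h1
    have hyD : y ∈ D := (hC₃s hyC₃).1.resolve_left hyC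
    obtain ⟨C₄, hC₄s, hC₄, hfC₄⟩ := hD.strong_elimination hC₃ hyD hyC₃ hf hfC₃
    -- Likewise `C₄` is not contained in `D`; a point of `C₄` outside `D` lies in `C`. So `C` and
    -- `C₄` meet, and their union misses `y`, which allows the induction.
    have h2 : ¬ C₄ ⊆ D := fun h =>
      (hC₄s (hC₄.eq_of_subset_isCircuit hD h ▸ hyD)).2 rfl
    obtain ⟨w, hwC₄, hwD⟩ := Set.not_subset.1 h2
    have hwC : w ∈ C := (hC₃s ((hC₄s hwC₄).1.resolve_left hwD)).1.resolve_right hwD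
    refine ih hC hC₄ he hfC₄ ⟨w, hwC, hwC₄⟩ ?_
    refine Nat.le_of_lt_succ (lt_of_lt_of_le (Set.ncard_lt_ncard ?_) hn)
    refine (Set.ssubset_iff_of_subset ?_).2 ⟨y, Or.inr hyD, ?_⟩
    · rintro a (ha | ha)
      · exact Or.inl ha
      · rcases (hC₄s ha).1 with ha | ha
        · exact Or.inr ha
        · exact (hC₃s ha).1
    · rintro (h | h)
      · exact hyC h
      · exact (hC₄s h).2 rfl

namespace RigidityTheory

open MvPolynomial

lemma exists_coloring_of_not_matroidConnected {α : Type*} [Finite α] {M : Matroid α}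
    (hM : ¬ MatroidConnected M) :
    ∃ c : α → Bool, (∃ e, c e = true) ∧ (∃ e, c e = false) ∧
      ∀ C, M.IsCircuit C → ∀ e ∈ C, ∀ f ∈ C, c e = c f := by
  classical
  unfold MatroidConnected at hM
  push Not at hM
  obtain ⟨e, -, f, -, hne, hef⟩ := hM
  let R : α → Prop := fun x => x = e ∨ ∃ C, M.IsCircuit C ∧ e ∈ C ∧ x ∈ C
  have hR : ∀ C, M.IsCircuit C → ∀ x ∈ C, ∀ y ∈ C, R x → R y := by
    rintro C hC x hx y hy (rfl | ⟨D, hD, heD, hxD⟩)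
    · exact Or.inr ⟨C, hC, hx, hy⟩
    · exact Or.inr (Matroid.exists_isCircuit_trans _ hD hC heD hy ⟨x, hxD, hx⟩ le_rfl)
  refine ⟨fun x => decide (R x), ⟨e, decide_eq_true (Or.inl rfl)⟩, ⟨f, decide_eq_false ?_⟩,
    fun C hC x hx y hy => decide_eq_decide.2 ⟨hR C hC x hx y hy, hR C hC y hy x hx⟩⟩
  rintro (rfl | ⟨C, hC, heC, hfC⟩)
  · exact hne rfl
  · exact hef C hC heC hfC

/-- If all circuits are monochromatic, so are the fundamental circuits of a base `B`: every element
outside `B` depends on the elements of `B` of its own colour. -/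
lemma exists_isBase_of_coloring {α : Type*} {M : Matroid α} (hE : M.E = Set.univ) {c : α → Bool}
    (hc : ∀ C, M.IsCircuit C → ∀ e ∈ C, ∀ f ∈ C, c e = c f) :
    ∃ B, M.Indep B ∧ ∀ e ∉ B, ¬ M.Indep (insert e {f ∈ B | c f = c e}) := by
  obtain ⟨B, hB⟩ := M.exists_isBase
  refine ⟨B, hB.indep, fun e he hind => ?_⟩
  have hcl : e ∈ M.closure B := by rw [hB.closure_eq, hE]; trivial
  have hC := hB.indep.fundCircuit_isCircuit hcl he
  refine hC.not_indep (hind.subset fun f hf => ?_)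
  rcases M.fundCircuit_subset_insert e B hf with rfl | hfB
  · exact Or.inl rfl
  · exact Or.inr ⟨hfB, hc _ hC f hf e (M.mem_fundCircuit e B)⟩

lemma vectorMatroid_ground {ι K M : Type*} [Finite ι] [Field K] [AddCommGroup M] [Module K M]
    (v : ι → M) : (vectorMatroid (K := K) v).E = Set.univ :=
  rfl

/-! ### Squared lengths and the rigidity matroid -/

/-- The squared length of a pair of vertices as a polynomial with rational coefficients in the
coordinates of the configuration. -/
noncomputable def sqLengthPoly {V : Type*} (d : ℕ) : Sym2 V → MvPolynomial (V × Fin d) ℚ :=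
  Sym2.lift ⟨fun u v => ∑ k, (X (u, k) - X (v, k)) ^ 2, fun u v =>
    Finset.sum_congr rfl fun k _ => by ring⟩

lemma sqLengthPoly_mk {V : Type*} (d : ℕ) (u v : V) :
    sqLengthPoly d s(u, v) = ∑ k, (X (u, k) - X (v, k)) ^ 2 := rfl

lemma sqLength_mk {V : Type*} {d : ℕ} (p : V → Fin d → ℂ) (u v : V) :
    sqLength p s(u, v) = ∑ k, (p u k - p v k) ^ 2 := rfl

lemma aeval_sqLengthPoly {V : Type*} {d : ℕ} (p : V → Fin d → ℂ) (e : Sym2 V) :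
    aeval (fun x : V × Fin d => p x.1 x.2) (sqLengthPoly d e) = sqLength p e := by
  induction e with | _ u v
  simp [sqLengthPoly_mk, sqLength_mk]

lemma sqLength_comp {V W : Type*} {d : ℕ} (p : V → Fin d → ℂ) (f : W → V) (e : Sym2 W) :
    sqLength (fun w => p (f w)) e = sqLength p (e.map f) := by
  induction e with | _ u v
  rfl

/-- Polynomial relations among squared lengths that hold in a generic configuration hold in all
configurations. -/
lemma aeval_sqLength_eq_zero {ι V : Type*} {d : ℕ} {p : V → Fin d → ℂ} (hp : IsGeneric p)
    (f : ι → Sym2 V) {P : MvPolynomial ι ℚ} (hP : aeval (fun i => sqLength p (f i)) P = 0)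
    (q : V → Fin d → ℂ) : aeval (fun i => sqLength q (f i)) P = 0 := by
  have key : ∀ r : V → Fin d → ℂ, aeval (fun i => sqLength r (f i)) P =
      aeval (fun x : V × Fin d => r x.1 x.2) (bind₁ (fun i => sqLengthPoly d (f i)) P) := by
    intro r
    rw [aeval_bind₁]
    simp_rw [aeval_sqLengthPoly]
  rw [key] at hP ⊢
  rw [algebraicIndependent_iff.1 hp _ hP, map_zero]

open scoped Classical in
lemma rigidityRow_mk {V K : Type*} [Field K] {d : ℕ} (p : V → Fin d → K) (u v : V)
    (x : V × Fin d) : rigidityRow p s(u, v) x =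
      (if x.1 = u then p u x.2 - p v x.2 else 0) + (if x.1 = v then p v x.2 - p u x.2 else 0) :=
  rfl

lemma D_aeval_sqLengthPoly {V K : Type*} [Fintype V] [Field K] [Algebra ℚ K] {d : ℕ}
    (p : V → Fin d → K) (e : Sym2 V) :
    KaehlerDifferential.D ℚ K (aeval (fun x : V × Fin d => p x.1 x.2) (sqLengthPoly d e)) =
      (2 : K) • ∑ x, rigidityRow p e x • KaehlerDifferential.D ℚ K (p x.1 x.2) := by
  classical
  induction e with | _ u v
  simp only [rigidityRow_mk, add_smul, ite_smul, zero_smul, Finset.sum_add_distrib,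
    Fintype.sum_prod_type_right, Finset.sum_ite_eq', Finset.mem_univ, if_true, sqLengthPoly_mk,
    map_sum, map_pow, map_sub, aeval_X, Derivation.leibniz_pow]
  rw [← Finset.sum_add_distrib, Finset.smul_sum]
  refine Finset.sum_congr rfl fun k _ => ?_
  rw [← Nat.cast_smul_eq_nsmul K]
  simp only [Nat.cast_ofNat, pow_one, Nat.add_one_sub_one]
  module

/-- The rigidity matroid of a generic framework is the algebraic matroid of its squared edge
lengths. -/
lemma algebraicIndepOn_sqLengthPoly_iff {V K : Type*} [Finite V] [Field K] [Algebra ℚ K] {d : ℕ}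
    {p : V → Fin d → K} (hp : IsGeneric p) (G : SimpleGraph V) (S : Set G.edgeSet) :
    AlgebraicIndepOn ℚ (fun e : G.edgeSet =>
      aeval (fun x : V × Fin d => p x.1 x.2) (sqLengthPoly d (e : Sym2 V))) S ↔
      (rigidityMatroid G p).Indep S := by
  have := Fintype.ofFinite V
  have : CharZero K := charZero_of_injective_algebraMap (algebraMap ℚ K).injective
  rw [algebraicIndepOn_iff_linearIndepOn_D _ S.toFinite]
  simp_rw [D_aeval_sqLengthPoly]
  have hD := AlgebraicIndependent.linearIndependent_D hp
  let T : (V × Fin d → K) →ₗ[K] Ω[K⁄ℚ] := (2 : K) • Fintype.linearCombination K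
    (fun x : V × Fin d => KaehlerDifferential.D ℚ K (p x.1 x.2))
  have hT : LinearMap.ker T = ⊥ := by
    rw [LinearMap.ker_smul _ _ two_ne_zero]
    exact LinearMap.ker_eq_bot.2 hD.fintypeLinearCombination_injective
  exact LinearMap.linearIndependent_iff T hT

lemma IsGeneric.ofReal {V : Type*} {d : ℕ} {p : V → Fin d → ℝ} (hp : IsGeneric p) :
    IsGeneric fun v k => (p v k : ℂ) :=
  AlgebraicIndependent.map' hp (f := Complex.ofRealAm.restrictScalars ℚ) Complex.ofReal_injective

lemma algebraicIndepOn_sqLength_ofReal_iff {V : Type*} [Finite V] {d : ℕ}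
    {p : V → Fin d → ℝ} (hp : IsGeneric p) (G : SimpleGraph V) (S : Set G.edgeSet) :
    AlgebraicIndepOn ℚ (fun e : G.edgeSet => sqLength (fun v k => (p v k : ℂ)) (e : Sym2 V)) S ↔
      (rigidityMatroid G p).Indep S := by
  rw [← algebraicIndepOn_sqLengthPoly_iff hp]
  have : ∀ e : Sym2 V, sqLength (fun v k => (p v k : ℂ)) e =
      ((aeval (fun x : V × Fin d => p x.1 x.2) (sqLengthPoly d e) : ℝ) : ℂ) := by
    intro e
    induction e with | _ u v
    simp [sqLengthPoly_mk, sqLength_mk]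
  simp_rw [this]
  exact AlgHom.algebraicIndependent_iff (Complex.ofRealAm.restrictScalars ℚ)
    Complex.ofReal_injective

/-! ### Splitting the vertices along a colouring of the edges -/

/-- The vertices of the graph obtained by splitting the vertices of `G` along the edge colouring
`c`: the pairs of a vertex of `G` and a colour that it meets. Only the values of `c` on edges of `G`
matter. -/
abbrev SplitVertex {V : Type*} (G : SimpleGraph V) (c : Sym2 V → Bool) : Type _ :=
  {x : V × Bool // ∃ w, G.Adj x.1 w ∧ c s(x.1, w) = x.2}

/-- The disjoint union of the two coloured subgraphs of `G`, without their isolated vertices. -/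
def splitGraph {V : Type*} (G : SimpleGraph V) (c : Sym2 V → Bool) :
    SimpleGraph (SplitVertex G c) where
  Adj x y := G.Adj x.1.1 y.1.1 ∧ c s(x.1.1, y.1.1) = x.1.2 ∧ c s(x.1.1, y.1.1) = y.1.2
  symm := ⟨fun x y h => ⟨h.1.symm, by rw [Sym2.eq_swap]; exact ⟨h.2.2, h.2.1⟩⟩⟩
  loopless := ⟨fun x h => h.1.ne rfl⟩

/-- The projection forgetting the colours of the vertices. -/
def splitHom {V : Type*} (G : SimpleGraph V) (c : Sym2 V → Bool) : splitGraph G c →g G where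
  toFun x := x.1.1
  map_rel' h := h.1

lemma splitHom_mapEdgeSet_bijective {V : Type*} (G : SimpleGraph V) (c : Sym2 V → Bool) :
    Function.Bijective (splitHom G c).mapEdgeSet := by
  constructor
  · rintro ⟨e, he⟩ ⟨f, hf⟩ h
    induction e with | _ x y
    induction f with | _ z w
    have h' : s(x.1.1, y.1.1) = s(z.1.1, w.1.1) := congrArg Subtype.val h
    have hc := congrArg c h'
    obtain ⟨-, hx, hy⟩ := he
    obtain ⟨-, hz, hw⟩ := hf
    refine Subtype.ext (Sym2.eq_iff.2 ?_)
    rcases Sym2.eq_iff.1 h' with ⟨h1, h2⟩ | ⟨h1, h2⟩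
    · exact Or.inl ⟨Subtype.ext (Prod.ext h1 (hx.symm.trans (hc.trans hz))),
        Subtype.ext (Prod.ext h2 (hy.symm.trans (hc.trans hw)))⟩
    · exact Or.inr ⟨Subtype.ext (Prod.ext h1 (hx.symm.trans (hc.trans hw))),
        Subtype.ext (Prod.ext h2 (hy.symm.trans (hc.trans hz)))⟩
  · rintro ⟨e, he⟩
    induction e with | _ u v
    exact ⟨⟨s(⟨(u, c s(u, v)), v, he, rfl⟩, ⟨(v, c s(u, v)), u, he.symm, by rw [Sym2.eq_swap]⟩),
      he, rfl, rfl⟩, rfl⟩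

/-- Every edge of `G` lifts to exactly one edge of `splitGraph G c`. -/
noncomputable def splitEdgeEquiv {V : Type*} (G : SimpleGraph V) (c : Sym2 V → Bool) :
    G.edgeSet ≃ (splitGraph G c).edgeSet :=
  (Equiv.ofBijective _ (splitHom_mapEdgeSet_bijective G c)).symm

lemma map_splitEdgeEquiv {V : Type*} (G : SimpleGraph V) (c : Sym2 V → Bool) (e : G.edgeSet) :
    Sym2.map (fun x : SplitVertex G c => x.1.1) (splitEdgeEquiv G c e : Sym2 _) = e :=
  congrArg Subtype.val
    ((Equiv.ofBijective _ (splitHom_mapEdgeSet_bijective G c)).apply_symm_apply e)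

lemma noIsolated_splitGraph {V : Type*} (G : SimpleGraph V) (c : Sym2 V → Bool) :
    NoIsolated (splitGraph G c) := by
  rintro ⟨⟨v, b⟩, w, hvw, hb⟩ h
  refine h ⟨(w, b), v, hvw.symm, by rw [Sym2.eq_swap]; exact hb⟩ ⟨hvw, hb, hb⟩

open scoped Classical in
/-- The configuration of `V` that agrees with `q` on the copies of colour `b`; vertices not meeting
the colour `b` are placed at the origin. -/
noncomputable def colorRestrict {V : Type*} {d : ℕ} {G : SimpleGraph V} {c : Sym2 V → Bool}
    (q : SplitVertex G c → Fin d → ℂ) (b : Bool) (v : V) : Fin d → ℂ :=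
  if h : ∃ w, G.Adj v w ∧ c s(v, w) = b then q ⟨(v, b), h⟩ else 0

lemma sqLength_splitEdgeEquiv {V : Type*} {d : ℕ} {G : SimpleGraph V} {c : Sym2 V → Bool}
    (q : SplitVertex G c → Fin d → ℂ) (e : G.edgeSet) :
    sqLength q (splitEdgeEquiv G c e : Sym2 _) = sqLength (colorRestrict q (c e)) (e : Sym2 V) := by
  rw [← map_splitEdgeEquiv G c e]
  obtain ⟨f, hf⟩ := splitEdgeEquiv G c e
  induction f with | _ x y
  obtain ⟨-, hx, hy⟩ := hf
  have key : ∀ z : SplitVertex G c, c s(x.1.1, y.1.1) = z.1.2 →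
      colorRestrict q (c s(x.1.1, y.1.1)) z.1.1 = q z := by
    rintro ⟨⟨z, b⟩, hz⟩ h
    rw [h]
    exact dif_pos hz
  simp only [Sym2.map_mk, sqLength_mk, key x hx, key y hy]

/-- If the lengths of every edge outside `B` depend on those of the edges of `B` of its own colour,
then the lengths of the generic framework `(G, p)` are those of a generic framework of the split
graph. -/
lemma exists_isGeneric_splitGraph {V : Type*} [Finite V] {d : ℕ} {G : SimpleGraph V}
    (c : Sym2 V → Bool) {p : V → Fin d → ℂ} (hp : IsGeneric p) {B : Set G.edgeSet}
    (hB : AlgebraicIndepOn ℚ (fun e : G.edgeSet => sqLength p (e : Sym2 V)) B)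
    (hcB : ∀ e ∉ B, ¬ AlgebraicIndepOn ℚ (fun e : G.edgeSet => sqLength p (e : Sym2 V))
      (insert e {f ∈ B | c f = c e})) :
    ∃ q : SplitVertex G c → Fin d → ℂ, IsGeneric q ∧
      LengthEquivalent G p (splitGraph G c) q (splitEdgeEquiv G c) := by
  obtain ⟨r, hr⟩ := Complex.exists_algebraicIndependent (SplitVertex G c × Fin d)
  let q₀ : SplitVertex G c → Fin d → ℂ := fun x k => r (x, k)
  have hq₀ : IsGeneric q₀ := hr
  have hzy : ∀ P : MvPolynomial G.edgeSet ℚ,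
      aeval (fun e : G.edgeSet => sqLength q₀ (splitEdgeEquiv G c e : Sym2 _)) P = 0 →
      aeval (fun e : G.edgeSet => sqLength p (e : Sym2 V)) P = 0 := by
    intro P hP
    have := aeval_sqLength_eq_zero hq₀ _ hP (fun x => p x.1.1)
    simpa only [sqLength_comp, map_splitEdgeEquiv] using this
  have hyz : ∀ b, ∀ P : MvPolynomial {e : G.edgeSet | c e = b} ℚ,
      aeval (fun e : {e : G.edgeSet | c e = b} => sqLength p ((e : G.edgeSet) : Sym2 V)) P = 0 →
      aeval (fun e : {e : G.edgeSet | c e = b} =>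
        sqLength q₀ (splitEdgeEquiv G c e : Sym2 _)) P = 0 := by
    intro b P hP
    have := aeval_sqLength_eq_zero hp _ hP (colorRestrict q₀ b)
    convert this using 4 with e
    rw [sqLength_splitEdgeEquiv, show c (e : G.edgeSet) = b from e.2]
  obtain ⟨σ, hσ⟩ := Complex.exists_ringHom_of_aeval_eq_zero_iff fun P =>
    ⟨hzy P, MvPolynomial.aeval_eq_zero_of_coloring (fun e : G.edgeSet => c e) hzy hyz hB hcB P⟩
  refine ⟨fun x k => σ (q₀ x k), ?_, fun e => ?_⟩
  · exact AlgebraicIndependent.map' hq₀ (f := σ.toRatAlgHom) σ.injective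
  · rw [← hσ e]
    generalize (splitEdgeEquiv G c e : Sym2 (SplitVertex G c)) = f
    induction f with | _ x y
    simp [sqLength_mk]

lemma not_equiv_splitVertex {V : Type*} [Finite V] {G : SimpleGraph V} (hG : NoIsolated G)
    {c : Sym2 V → Bool} {v u w : V} (hu : G.Adj v u) (hw : G.Adj v w) (hcu : c s(v, u) = true)
    (hcw : c s(v, w) = false) : IsEmpty (V ≃ SplitVertex G c) := by
  refine ⟨fun φ => ?_⟩
  have hsurj : Function.Surjective fun x : SplitVertex G c => x.1.1 := by
    intro v
    obtain ⟨w, hvw⟩ : ∃ w, G.Adj v w := by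
      by_contra! h
      exact hG v h
    exact ⟨⟨(v, c s(v, w)), w, hvw, rfl⟩, rfl⟩
  have hinj := Finite.injective_iff_surjective.2 (hsurj.comp φ.surjective)
  have hinj' : Function.Injective fun x : SplitVertex G c => x.1.1 := by
    have := hinj.comp φ.symm.injective
    simpa [Function.comp_assoc] using this
  have := @hinj' ⟨(v, true), u, hu, hcu⟩ ⟨(v, false), w, hw, hcw⟩ rfl
  simp at this

/-! ### Gluing two vertices in different components -/

open scoped Classical in
/-- The map identifying `v₂` with `v₁`; the vertex `v₁` represents the merged vertex. -/
noncomputable def glueMap {V : Type*} {v₁ v₂ : V} (h : v₁ ≠ v₂) (v : V) : {v : V // v ≠ v₂} :=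
  if hv : v = v₂ then ⟨v₁, h⟩ else ⟨v, hv⟩

lemma glueMap_self {V : Type*} {v₁ v₂ : V} (h : v₁ ≠ v₂) : glueMap h v₂ = ⟨v₁, h⟩ :=
  dif_pos rfl

lemma glueMap_of_ne {V : Type*} {v₁ v₂ : V} (h : v₁ ≠ v₂) {v : V} (hv : v ≠ v₂) :
    glueMap h v = ⟨v, hv⟩ :=
  dif_neg hv

lemma eq_of_glueMap_eq {V : Type*} {v₁ v₂ : V} (h : v₁ ≠ v₂) {κ : V → Bool}
    (hv : κ v₁ ≠ κ v₂) {u v : V} (huv : κ u = κ v) (hf : glueMap h u = glueMap h v) : u = v := by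
  by_cases hu2 : u = v₂ <;> by_cases hv2 : v = v₂
  · rw [hu2, hv2]
  · subst hu2
    rw [glueMap_self, glueMap_of_ne h hv2, Subtype.mk.injEq] at hf
    exact absurd (hf ▸ huv.symm) hv
  · subst hv2
    rw [glueMap_self, glueMap_of_ne h hu2, Subtype.mk.injEq] at hf
    exact absurd (hf ▸ huv) hv
  · rw [glueMap_of_ne h hu2, glueMap_of_ne h hv2, Subtype.mk.injEq] at hf
    exact hf

lemma glueMap_eq_of_ne {V : Type*} {v₁ v₂ : V} (h : v₁ ≠ v₂) {u v : V} (huv : u ≠ v)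
    (hf : glueMap h u = glueMap h v) : glueMap h u = ⟨v₁, h⟩ := by
  by_cases hu2 : u = v₂
  · rw [hu2, glueMap_self]
  by_cases hv2 : v = v₂
  · rw [hf, hv2, glueMap_self]
  rw [glueMap_of_ne h hu2, glueMap_of_ne h hv2, Subtype.mk.injEq] at hf
  exact absurd hf huv

lemma bijective_mapEdgeSet_glueMap {V : Type*} {G : SimpleGraph V} {v₁ v₂ : V} (h : v₁ ≠ v₂)
    {κ : V → Bool} (hv : κ v₁ ≠ κ v₂) (hκ : ∀ u v, G.Adj u v → κ u = κ v)
    (hf : ∀ {u v}, G.Adj u v → glueMap h u ≠ glueMap h v) :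
    Function.Bijective (SimpleGraph.Hom.map (glueMap h) G hf).mapEdgeSet := by
  constructor
  · rintro ⟨e, he⟩ ⟨e', he'⟩ hee
    induction e with | _ u v
    induction e' with | _ u' v'
    have key : ∀ a b a' b', G.Adj a b → G.Adj a' b' → glueMap h a = glueMap h a' →
        glueMap h b = glueMap h b' → a = a' ∧ b = b' := by
      intro a b a' b' hab hab' h1 h2
      have hc : κ a = κ a' := by
        by_contra hne
        have ha := glueMap_eq_of_ne h (fun h => hne (congrArg κ h)) h1
        have hb := glueMap_eq_of_ne h
          (fun h => hne ((hκ _ _ hab).trans ((congrArg κ h).trans (hκ _ _ hab').symm))) h2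
        exact hf hab (ha.trans hb.symm)
      exact ⟨eq_of_glueMap_eq h hv hc h1,
        eq_of_glueMap_eq h hv ((hκ _ _ hab).symm.trans (hc.trans (hκ _ _ hab'))) h2⟩
    have h' : s(glueMap h u, glueMap h v) = s(glueMap h u', glueMap h v') :=
      congrArg Subtype.val hee
    refine Subtype.ext (Sym2.eq_iff.2 ?_)
    exact (Sym2.eq_iff.1 h').imp (fun h => key _ _ _ _ he he' h.1 h.2)
      (fun h => key _ _ _ _ he (SimpleGraph.Adj.symm he') h.1 h.2)
  · rintro ⟨e, he⟩
    induction e with | _ x y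
    obtain ⟨-, u, v, huv, hx, hy⟩ := he
    exact ⟨⟨s(u, v), huv⟩, Subtype.ext (congrArg₂ (fun a b => s(a, b)) hx hy)⟩

/-- Translating the vertices in `S` by the difference of two vertices outside `S` is invertible
over `ℚ`, so it preserves genericity. -/
lemma IsGeneric.translate {V : Type*} {d : ℕ} {p : V → Fin d → ℂ} (hp : IsGeneric p) {S : Set V}
    {v₁ v₂ : V} (h₁ : v₁ ∉ S) (h₂ : v₂ ∉ S) [DecidablePred (· ∈ S)] :
    IsGeneric fun v k => p v k + if v ∈ S then p v₁ k - p v₂ k else 0 := by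
  let Φ : MvPolynomial (V × Fin d) ℚ →ₐ[ℚ] MvPolynomial (V × Fin d) ℚ :=
    aeval fun x => X x + if x.1 ∈ S then X (v₁, x.2) - X (v₂, x.2) else 0
  let Ψ : MvPolynomial (V × Fin d) ℚ →ₐ[ℚ] MvPolynomial (V × Fin d) ℚ :=
    aeval fun x => X x - if x.1 ∈ S then X (v₁, x.2) - X (v₂, x.2) else 0
  have hΨ : Ψ.comp Φ = AlgHom.id ℚ _ := by
    ext1 x
    by_cases hx : x.1 ∈ S <;> simp [Φ, Ψ, hx, h₁, h₂]
  have hΦ : Function.Injective Φ :=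
    Function.LeftInverse.injective (g := Ψ) fun P => DFunLike.congr_fun hΨ P
  have hr := AlgebraicIndependent.aeval_of_injective hp Φ hΦ
  have hx : ∀ x, aeval (fun x : V × Fin d => p x.1 x.2) (Φ (X x)) =
      p x.1 x.2 + if x.1 ∈ S then p v₁ x.2 - p v₂ x.2 else 0 := by
    intro x
    by_cases hx : x.1 ∈ S <;> simp [Φ, hx]
  simp_rw [hx] at hr
  exact hr

/-- If the vertex colouring `κ` is constant along edges, then on the graph obtained by identifying
two vertices of different colours there is a generic framework length-equivalent to `(G, p)`. -/
lemma exists_isGeneric_glue {V : Type*} {d : ℕ} {G : SimpleGraph V} (hG : NoIsolated G)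
    {v₁ v₂ : V} {κ : V → Bool} (hv₁ : κ v₁ = true) (hv₂ : κ v₂ = false)
    (hκ : ∀ u v, G.Adj u v → κ u = κ v) {p : V → Fin d → ℂ} (hp : IsGeneric p) :
    ∃ (H : SimpleGraph {v : V // v ≠ v₂}) (q : {v : V // v ≠ v₂} → Fin d → ℂ)
      (ψ : G.edgeSet ≃ H.edgeSet), NoIsolated H ∧ IsGeneric q ∧ LengthEquivalent G p H q ψ := by
  classical
  have hv : κ v₁ ≠ κ v₂ := by simp [hv₁, hv₂]
  have h : v₁ ≠ v₂ := fun h => hv (congrArg κ h)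
  have hf : ∀ {u v}, G.Adj u v → glueMap h u ≠ glueMap h v := fun huv hf =>
    huv.ne (eq_of_glueMap_eq h hv (hκ _ _ huv) hf)
  -- The vertex `v₂` itself is kept in place, so that the translation is by a fixed vector; its own
  -- position is dropped when it is merged with `v₁`.
  let S : Set V := {v | κ v = false ∧ v ≠ v₂}
  let r : V → Fin d → ℂ := fun v k => p v k + if v ∈ S then p v₁ k - p v₂ k else 0
  have hr : IsGeneric r := hp.translate (by simp [S, hv₁]) (by simp [S])
  refine ⟨G.map (glueMap h), fun w => r w, Equiv.ofBijective _
    (bijective_mapEdgeSet_glueMap h hv hκ hf), ?_, ?_, ?_⟩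
  · rintro ⟨v, hvv⟩ hiso
    obtain ⟨w, hvw⟩ : ∃ w, G.Adj v w := by
      by_contra! h
      exact hG v h
    have := (SimpleGraph.Hom.map (glueMap h) G hf).map_adj hvw
    change (G.map (glueMap h)).Adj (glueMap h v) (glueMap h w) at this
    rw [glueMap_of_ne h hvv] at this
    exact hiso _ this
  · exact AlgebraicIndependent.comp hr (fun x : {v : V // v ≠ v₂} × Fin d => (x.1.1, x.2))
      fun x y hxy => by
        simp only [Prod.mk.injEq] at hxy
        exact Prod.ext (Subtype.ext hxy.1) hxy.2
  · have key : ∀ v k, r (glueMap h v) k = p v k + if κ v then 0 else p v₁ k - p v₂ k := by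
      intro v k
      by_cases hv' : v = v₂
      · subst hv'
        simp [glueMap_self, r, S, hv₁, hv₂]
      · rw [glueMap_of_ne h hv']
        by_cases hκv : κ v = true <;> simp [r, S, hκv, hv']
    rintro ⟨e, he⟩
    induction e with | _ u v
    change sqLength p s(u, v) = sqLength (fun w => r (w : {v : V // v ≠ v₂}).1)
      s(glueMap h u, glueMap h v)
    simp only [sqLength_mk, key, hκ u v he, add_sub_add_right_eq_sub]

/-! ### Full reconstructibility implies connectivity -/

theorem IsFullyReconstructible.isMConnected {V : Type u} [Finite V] {d : ℕ} {G : SimpleGraph V}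
    (hG : NoIsolated G) (hrec : IsFullyReconstructible d G) : IsMConnected d G := by
  classical
  intro p hp
  by_contra hM
  obtain ⟨c', ⟨⟨e₁, he₁⟩, hc₁⟩, ⟨⟨e₂, he₂⟩, hc₂⟩, hc'⟩ := exists_coloring_of_not_matroidConnected hM
  let c : Sym2 V → Bool := fun e => if h : e ∈ G.edgeSet then c' ⟨e, h⟩ else true
  have hcc : ∀ e : G.edgeSet, c e = c' e := fun e => dif_pos e.2
  have hpC := IsGeneric.ofReal hp
  have hrecp := hrec _ hpC
  -- If some vertex meets both colours the graph is split, otherwise two vertices are glued.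
  by_cases hmix : ∃ v u w, G.Adj v u ∧ G.Adj v w ∧ c s(v, u) = true ∧ c s(v, w) = false
  · obtain ⟨v, u, w, hu, hw, hcu, hcw⟩ := hmix
    obtain ⟨B, hB, hcB⟩ := exists_isBase_of_coloring (vectorMatroid_ground _) hc'
    obtain ⟨q, hq, hlen⟩ := exists_isGeneric_splitGraph c hpC
      ((algebraicIndepOn_sqLength_ofReal_iff hp G B).2 hB) fun e he h => hcB e he <| by
        simp_rw [hcc] at h
        exact (algebraicIndepOn_sqLength_ofReal_iff hp G _).1 h
    obtain ⟨φ, -⟩ := hrecp _ _ q _ (noIsolated_splitGraph G c) hq hlen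
    exact (not_equiv_splitVertex hG hu hw hcu hcw).false φ.toEquiv
  · push Not at hmix
    induction e₁ with | _ v₁ u₁
    induction e₂ with | _ v₂ u₂
    have hc₁' : c s(v₁, u₁) = true := (hcc ⟨_, he₁⟩).trans hc₁
    have hc₂' : c s(v₂, u₂) = false := (hcc ⟨_, he₂⟩).trans hc₂
    -- All edges at a vertex have the same colour, which colours the vertices.
    let κ : V → Bool := fun v => decide (∃ u, G.Adj v u ∧ c s(v, u) = true)
    have hκ1 : ∀ u v, G.Adj u v → κ u = c s(u, v) := by
      intro u v huv
      cases h : c s(u, v)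
      · refine decide_eq_false ?_
        rintro ⟨w, huw, hw⟩
        exact hmix u w v huw huv hw h
      · exact decide_eq_true ⟨v, huv, h⟩
    have hκ : ∀ u v, G.Adj u v → κ u = κ v := fun u v huv => by
      rw [hκ1 u v huv, hκ1 v u huv.symm, Sym2.eq_swap]
    obtain ⟨H, q, ψ, hH, hq, hlen⟩ := exists_isGeneric_glue hG ((hκ1 _ _ he₁).trans hc₁')
      ((hκ1 _ _ he₂).trans hc₂') hκ hpC
    obtain ⟨φ, -⟩ := hrecp _ H q ψ hH hq hlen
    have hinj : Function.Injective fun v => (φ v : V) :=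
      Subtype.val_injective.comp φ.injective
    obtain ⟨v, hv⟩ := Finite.injective_iff_surjective.1 hinj v₂
    exact (φ v).2 hv

end RigidityTheory

theorem theorem3p7 {V : Type u} [Finite V] (d : ℕ) (hd : 1 ≤ d) (G : SimpleGraph V)
    (hG : RigidityTheory.NoIsolated G) (hrec : RigidityTheory.IsFullyReconstructible d G) :
    RigidityTheory.IsMConnected d G := by
  exact RigidityTheory.IsFullyReconstructible.isMConnected hG hrec
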